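/- For a nonempty integer partition $\pi$ let $s(\pi)$ denote its smallest part, and for $l\ge 1$ let $\delta_l$ be the triangular partition $(l-1,l-2,\dots,1)$ (empty for $l=1$). For an integer $n\ge 0$ consider all pairs $(\pi,\delta_{s(\pi)})$ of total size $n$, i.e. all nonempty partitions $\pi$ with $|\pi|+\binom{s(\pi)}{2}=n$, such that no odd part of $\pi$ is greater than $2s(\pi)$. Let $spt_o^{-}(n)$ be the sum, over all these pairs, of the number of times the smallest part $s(\pi)$ occurs in $\pi$ (so $spt_o^{-}(0)=0$). Then, for every integer $n\ge 0$, $$spt_o^{-}(2n)\equiv 0 \pmod 2 .$$ -/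

import Mathlib

/-- The smallest part `s(π)` of a partition `π` (with the value `0` for the empty partition). -/
def smallestPart {m : ℕ} (π : m.Partition) : ℕ :=
  π.parts.toFinset.min.untopD 0

/-- The parts of the triangular partition `δ_l = (l - 1, l - 2, …, 1)`. -/
def triangularParts (l : ℕ) : Multiset ℕ :=
  (Finset.Ico 1 l).val

/-- Odd parts greater than `2 s(π)` do not occur in `π`. -/
def NoLargeOddParts {m : ℕ} (π : m.Partition) : Prop :=
  ∀ a ∈ π.parts, Odd a → a ≤ 2 * smallestPart π

instance {m : ℕ} (π : m.Partition) : Decidable (NoLargeOddParts π) :=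
  inferInstanceAs (Decidable (∀ a ∈ π.parts, Odd a → a ≤ 2 * smallestPart π))

/-- `spt_o⁻(n)`: the total number of occurrences of the smallest part `s(π)` in `π`, over all
partition pairs `(π, δ)` of `n` (that is, `|π| + |δ| = n`) in which `δ = δ_{s(π)}` and odd parts
greater than `2 s(π)` do not occur in `π`. The empty `π` has no parts and contributes `0`. -/
def sptOMinus (n : ℕ) : ℕ :=
  ∑ p ∈ Finset.HasAntidiagonal.antidiagonal n,
    ∑ σ : p.1.Partition × p.2.Partition with
        σ.2.parts = triangularParts (smallestPart σ.1) ∧ NoLargeOddParts σ.1,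
      σ.1.parts.count (smallestPart σ.1)

/-!
Partitions whose smallest part is `s` and whose odd parts are at most `2 s` are generated by a
product over the admissible parts. Weighting by the number of occurrences of `s` and by
`q^{s(s-1)/2}`, the generating function of `spt_o⁻` becomes `1 / (q²; q²)_∞` times
`∑ₙ qⁿ (q; q)_{n-1}² βₙ`, where `βₙ` belongs to a Bailey pair of Slater. Bailey's lemma with both
parameters tending to `1` writes that sum as `∑ₙ (1 + αₙ) qⁿ / (1 - qⁿ)²`. Modulo `2` this is the
sum of the Lambert series `∑ₙ qⁿ / (1 - q²ⁿ)` and `∑ᵣ q^{r(r+1)} / (1 - q²ʳ)`, which count the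
factorizations `k = c d` with `d` odd, respectively with `c < d` of opposite parities. These counts
agree for even `k`, and `1 / (q²; q²)_∞` involves even powers of `q` only, so all even coefficients
of the product vanish. Products and sums are truncated at a bound `N` beyond the degree considered.
-/

open Finset PowerSeries
open scoped Ring

theorem map_ringInverse {M N F : Type*} [MonoidWithZero M] [MonoidWithZero N] [FunLike F M N]
    [MonoidHomClass F M N] (f : F) {a : M} (ha : IsUnit a) : f a⁻¹ʳ = (f a)⁻¹ʳ := by
  obtain ⟨u, rfl⟩ := ha
  rw [Ring.inverse_unit]
  exact (Ring.inverse_unit (Units.map (f : M →* N) u)).symm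

section QPochhammer

variable {R S : Type*} [CommRing R] [CommRing S]

/-- The `q`-Pochhammer symbol `(q; q)_n = (1 - q) (1 - q²) ⋯ (1 - qⁿ)`. Its reciprocals are written
with `Ring.inverse`, so that `q` can live in any commutative ring in which the factors `1 - qⁱ` are
units, such as a ring of power series. -/
def qPoch (q : R) (n : ℕ) : R :=
  ∏ i ∈ Ioc 0 n, (1 - q ^ i)

theorem qPoch_zero (q : R) : qPoch q 0 = 1 := by
  simp [qPoch]

theorem qPoch_succ (q : R) (n : ℕ) : qPoch q (n + 1) = qPoch q n * (1 - q ^ (n + 1)) :=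
  prod_Ioc_succ_top n.zero_le _

theorem map_qPoch (φ : R →+* S) (q : R) (n : ℕ) : φ (qPoch q n) = qPoch (φ q) n := by
  simp [qPoch, map_prod]

variable {q : R}

theorem isUnit_qPoch (hq : ∀ n ≠ 0, IsUnit (1 - q ^ n)) (n : ℕ) : IsUnit (qPoch q n) :=
  IsUnit.prod_iff.2 fun i hi => hq i (mem_Ioc.1 hi).1.ne'

theorem inverse_qPoch (hq : ∀ n ≠ 0, IsUnit (1 - q ^ n)) (n : ℕ) :
    (qPoch q n)⁻¹ʳ = (1 - q ^ (n + 1)) * (qPoch q (n + 1))⁻¹ʳ := by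
  have hu := hq (n + 1) n.succ_ne_zero
  rw [qPoch_succ, Ring.inverse_mul (.inr hu), ← mul_assoc, Ring.mul_inverse_cancel _ hu, one_mul]

theorem prod_Ioc_inverse_one_sub_pow (hq : ∀ n ≠ 0, IsUnit (1 - q ^ n)) {a b : ℕ} (hab : a ≤ b) :
    ∏ i ∈ Ioc a b, (1 - q ^ i)⁻¹ʳ = qPoch q a * (qPoch q b)⁻¹ʳ := by
  have hsplit : (∏ i ∈ Ioc a b, (1 - q ^ i)) * qPoch q a = qPoch q b :=
    (mul_comm _ _).trans (prod_Ioc_consecutive _ a.zero_le hab)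
  have hinv : ∏ i ∈ Ioc a b, (1 - q ^ i)⁻¹ʳ = (∏ i ∈ Ioc a b, (1 - q ^ i))⁻¹ʳ :=
    (map_prod MonoidWithZero.inverse _ _).symm
  have ha := isUnit_qPoch hq a
  rw [hinv, ← hsplit, Ring.inverse_mul (.inr ha), ← mul_assoc, Ring.mul_inverse_cancel _ ha,
    one_mul]

end QPochhammer

section BaileyKernel

variable {R : Type*} [CommRing R] {q : R}

/-- The kernel `1 / ((q; q)_{n-k} (q; q)_{n+k})` of Bailey's lemma relative to `1`, extended by `0`
to `n < k`. -/
noncomputable def baileyKernel (q : R) (n k : ℕ) : R :=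
  if k ≤ n then (qPoch q (n - k))⁻¹ʳ * (qPoch q (n + k))⁻¹ʳ else 0

theorem baileyKernel_eq_zero {n k : ℕ} (h : n < k) : baileyKernel q n k = 0 :=
  if_neg h.not_ge

theorem baileyKernel_add_left (q : R) (m k : ℕ) :
    baileyKernel q (m + k) k = (qPoch q m)⁻¹ʳ * (qPoch q (m + k + k))⁻¹ʳ := by
  rw [baileyKernel, if_pos (k.le_add_left m), Nat.add_sub_cancel]

theorem baileyKernel_zero_right (q : R) (n : ℕ) : baileyKernel q n 0 = (qPoch q n)⁻¹ʳ ^ 2 := by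
  simpa [sq] using baileyKernel_add_left q n 0

variable (hq : ∀ n ≠ 0, IsUnit (1 - q ^ n))
include hq

theorem baileyKernel_eq_mul_succ_left (n k : ℕ) :
    baileyKernel q n k =
      (1 - q ^ (n + 1 - k)) * (1 - q ^ (n + 1 + k)) * baileyKernel q (n + 1) k := by
  obtain h | h := lt_or_ge n k
  · simp [baileyKernel_eq_zero h, Nat.sub_eq_zero_of_le (Nat.succ_le_of_lt h)]
  · obtain ⟨m, rfl⟩ := Nat.exists_eq_add_of_le' h
    rw [baileyKernel_add_left, inverse_qPoch hq m, inverse_qPoch hq (m + k + k),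
      show m + k + 1 = m + 1 + k by lia, baileyKernel_add_left, Nat.add_sub_cancel,
      show m + k + k + 1 = m + 1 + k + k by lia]
    ring

theorem baileyKernel_eq_mul_succ_succ (n k : ℕ) (h : k ≤ n) :
    baileyKernel q n k =
      (1 - q ^ (n + k + 1)) * (1 - q ^ (n + k + 2)) * baileyKernel q (n + 1) (k + 1) := by
  obtain ⟨m, rfl⟩ := Nat.exists_eq_add_of_le' h
  rw [baileyKernel_add_left, inverse_qPoch hq (m + k + k), inverse_qPoch hq (m + k + k + 1),
    add_assoc m k 1, baileyKernel_add_left, show m + (k + 1) + (k + 1) = m + k + k + 1 + 1 by lia]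
  ring

theorem baileyKernel_add_two_eq_mul_succ (n k : ℕ) :
    baileyKernel q n (k + 2) =
      (1 - q ^ (n - k)) * (1 - q ^ (n - k - 1)) * baileyKernel q (n + 1) (k + 1) := by
  obtain h | h := lt_or_ge n (k + 2)
  · simp [baileyKernel_eq_zero h, show n - k - 1 = 0 by lia]
  · obtain ⟨m, rfl⟩ := Nat.exists_eq_add_of_le' h
    rw [baileyKernel_add_left, inverse_qPoch hq m, inverse_qPoch hq (m + 1),
      show m + (k + 2) + 1 = m + 2 + (k + 1) by lia, baileyKernel_add_left,
      show m + (k + 2) - k = m + 2 by lia,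
      show m + 2 + (k + 1) + (k + 1) = m + (k + 2) + (k + 2) by lia]
    simp only [show m + 2 - 1 = m + 1 by lia]
    ring

end BaileyKernel

section BaileyPair

variable {R : Type*} [CommRing R] {q : R} {α β : ℕ → R}

/-- `(α, β)` is a Bailey pair relative to `1`:
`βₙ = ∑_{k ≤ n} αₖ / ((q; q)_{n-k} (q; q)_{n+k})`. -/
def IsBaileyPair (q : R) (α β : ℕ → R) : Prop :=
  ∀ n, β n = ∑ k ∈ range (n + 1), α k * baileyKernel q n k

theorem sum_range_mul_baileyKernel (α : ℕ → R) {n N : ℕ} (h : n < N) :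
    ∑ k ∈ range (n + 1), α k * baileyKernel q n k = ∑ k ∈ range N, α k * baileyKernel q n k := by
  refine sum_subset (range_subset_range.2 h) fun k _ hk => ?_
  rw [baileyKernel_eq_zero (by simpa using hk), mul_zero]

variable (hq : ∀ n ≠ 0, IsUnit (1 - q ^ n))
include hq

theorem sum_qPoch_sq_mul_baileyKernel {k : ℕ} (hk : k ≠ 0) (N : ℕ) :
    ∑ n ∈ range N, q ^ (n + 1) * qPoch q n ^ 2 * baileyKernel q (n + 1) k =
      q ^ k * ((1 - q ^ k) ^ 2)⁻¹ʳ * (qPoch q N ^ 2 * baileyKernel q N k) := by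
  induction N with
  | zero => simp [baileyKernel_eq_zero hk.pos]
  | succ N ih =>
    rw [sum_range_succ, ih, baileyKernel_eq_mul_succ_left hq N k]
    obtain h | h := lt_or_ge (N + 1) k
    · simp [baileyKernel_eq_zero h]
    · obtain ⟨m, hm⟩ := Nat.exists_eq_add_of_le h
      have hinv := Ring.mul_inverse_cancel _ ((hq k hk).pow 2)
      rw [qPoch_succ, hm, Nat.add_sub_cancel_left]
      linear_combination
        (-(q ^ (k + m) * qPoch q N ^ 2 * baileyKernel q (k + m) k)) * hinv

theorem sum_qPoch_sq_mul_baileyKernel_zero (N : ℕ) :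
    ∑ n ∈ range N, q ^ (n + 1) * qPoch q n ^ 2 * baileyKernel q (n + 1) 0 =
      ∑ n ∈ range N, q ^ (n + 1) * ((1 - q ^ (n + 1)) ^ 2)⁻¹ʳ := by
  refine sum_congr rfl fun n _ => ?_
  have hinv := Ring.mul_inverse_cancel _ (isUnit_qPoch hq n)
  rw [baileyKernel_zero_right, qPoch_succ, Ring.inverse_mul (.inl (isUnit_qPoch hq n)), mul_pow,
    ← Ring.inverse_pow (1 - _)]
  linear_combination q ^ (n + 1) * (1 - q ^ (n + 1))⁻¹ʳ ^ 2 *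
    (qPoch q n * (qPoch q n)⁻¹ʳ + 1) * hinv

/-- A finite form of Bailey's lemma in which both parameters tend to `1` (after division by their
vanishing factors): as `N → ∞`, `(q; q)_N²` times the kernel tends to `1`. -/
theorem IsBaileyPair.sum_qPoch_sq_mul (h : IsBaileyPair q α β) (N : ℕ) :
    ∑ n ∈ range N, q ^ (n + 1) * qPoch q n ^ 2 * β (n + 1) =
      ∑ n ∈ range N, (α 0 + α (n + 1) * (qPoch q N ^ 2 * baileyKernel q N (n + 1))) *
        (q ^ (n + 1) * ((1 - q ^ (n + 1)) ^ 2)⁻¹ʳ) := by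
  calc
    _ = ∑ n ∈ range N, ∑ k ∈ range (N + 1),
          α k * (q ^ (n + 1) * qPoch q n ^ 2 * baileyKernel q (n + 1) k) := by
      refine sum_congr rfl fun n hn => ?_
      rw [h, sum_range_mul_baileyKernel α (Nat.succ_lt_succ (mem_range.1 hn)), mul_sum]
      exact sum_congr rfl fun k _ => by ring
    _ = ∑ k ∈ range (N + 1), α k *
          ∑ n ∈ range N, q ^ (n + 1) * qPoch q n ^ 2 * baileyKernel q (n + 1) k := by
      rw [sum_comm]
      simp only [mul_sum]
    _ = _ := by
      rw [sum_range_succ', sum_qPoch_sq_mul_baileyKernel_zero hq, mul_sum, ← sum_add_distrib]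
      refine sum_congr rfl fun n _ => ?_
      rw [sum_qPoch_sq_mul_baileyKernel hq n.add_one_ne_zero]
      ring

end BaileyPair

section SlaterPair

variable {R : Type*} [CommRing R] {q : R}

/-- The `α`-sequence of the Bailey pair used here, from Slater's group C: `α₀ = 1`, `αₖ = 0` for
odd `k`, and `α₂ᵣ = (-1)ʳ q^{r(r-1)} (1 + q^{2r})` for `r ≥ 1`. -/
def slaterAlpha (q : R) (k : ℕ) : R :=
  if k = 0 then 1
  else if Even k then (-1) ^ (k / 2) * q ^ (k / 2 * (k / 2 - 1)) * (1 + q ^ k)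
  else 0

/-- The `β`-sequence `βₙ = q^{n(n-1)/2} (q²; q²)ₙ / ((q; q)ₙ (q; q)₂ₙ)` matching `slaterAlpha`. -/
noncomputable def slaterBeta (q : R) (n : ℕ) : R :=
  q ^ n.choose 2 * qPoch (q ^ 2) n * (qPoch q n)⁻¹ʳ * (qPoch q (2 * n))⁻¹ʳ

theorem slaterAlpha_zero (q : R) : slaterAlpha q 0 = 1 :=
  if_pos rfl

theorem slaterAlpha_two_mul_add_one (q : R) (r : ℕ) : slaterAlpha q (2 * r + 1) = 0 := by
  simp [slaterAlpha]

theorem slaterAlpha_two_mul_add_two (q : R) (r : ℕ) :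
    slaterAlpha q (2 * r + 2) = (-1) ^ (r + 1) * q ^ ((r + 1) * r) * (1 + q ^ (2 * r + 2)) := by
  simp [slaterAlpha, Nat.even_add]

variable (hq : ∀ n ≠ 0, IsUnit (1 - q ^ n))
include hq

theorem slaterBeta_succ (n : ℕ) :
    (1 - q ^ (n + 1)) * (1 - q ^ (2 * n + 1)) * slaterBeta q (n + 1) = q ^ n * slaterBeta q n := by
  rw [slaterBeta, slaterBeta, inverse_qPoch hq n, inverse_qPoch hq (2 * n),
    inverse_qPoch hq (2 * n + 1), qPoch_succ, Nat.choose_succ_succ' n 1, Nat.choose_one_right,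
    mul_add_one 2 n]
  ring

theorem one_add_mul_baileyKernel_recurrence (n k : ℕ) :
    (1 + q ^ (k + 1)) * ((1 - q ^ (n + 1)) * (1 - q ^ (2 * n + 1)) * baileyKernel q (n + 1) (k + 1)
        - q ^ n * baileyKernel q n (k + 1)) =
      q ^ (k + 1) * baileyKernel q n (k + 2) + baileyKernel q n k := by
  obtain h | h := lt_or_ge n k
  · simp [baileyKernel_eq_zero, h, h.trans]
  · rw [baileyKernel_add_two_eq_mul_succ hq, baileyKernel_eq_mul_succ_succ hq n k h,
      baileyKernel_eq_mul_succ_left hq n (k + 1)]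
    obtain ⟨m, rfl⟩ := Nat.exists_eq_add_of_le h
    rw [Nat.add_sub_add_right, Nat.add_sub_cancel_left]
    have hpow : (1 - q ^ m) * (q * q ^ (m - 1)) = (1 - q ^ m) * q ^ m := by
      cases m with
      | zero => simp
      | succ m => rw [Nat.add_sub_cancel, pow_succ' q m]
    linear_combination q ^ k * baileyKernel q (k + m + 1) (k + 1) * hpow

theorem sum_slaterAlpha_mul_baileyKernel_sub (n r : ℕ) :
    ∑ k ∈ range (2 * r + 1), slaterAlpha q k *
        ((1 - q ^ (n + 1)) * (1 - q ^ (2 * n + 1)) * baileyKernel q (n + 1) k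
          - q ^ n * baileyKernel q n k) =
      (-1) ^ r * q ^ (r * (r + 1)) * baileyKernel q n (2 * r + 1) := by
  induction r with
  | zero =>
    have hone :
        baileyKernel q n 1 = (1 - q ^ n) * (1 - q ^ (n + 1)) * baileyKernel q (n + 1) 0 := by
      cases n with
      | zero => simp [baileyKernel_eq_zero]
      | succ n =>
        rw [baileyKernel_add_left, baileyKernel_zero_right, inverse_qPoch hq n,
          inverse_qPoch hq (n + 1)]
        ring
    rw [mul_zero, zero_add, sum_range_one, slaterAlpha_zero, hone,
      baileyKernel_eq_mul_succ_left hq n 0]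
    simp only [Nat.sub_zero, add_zero]
    ring
  | succ r ih =>
    rw [mul_add_one, sum_range_succ, sum_range_succ, ih, slaterAlpha_two_mul_add_one,
      slaterAlpha_two_mul_add_two]
    linear_combination (-1) ^ (r + 1) * q ^ ((r + 1) * r) *
      one_add_mul_baileyKernel_recurrence hq n (2 * r + 1)

theorem isBaileyPair_slater : IsBaileyPair q (slaterAlpha q) (slaterBeta q) := by
  intro n
  induction n with
  | zero => simp [slaterBeta, slaterAlpha_zero, baileyKernel_zero_right, qPoch_zero]
  | succ n ih =>
    have hu : IsUnit ((1 - q ^ (n + 1)) * (1 - q ^ (2 * n + 1))) :=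
      (hq _ n.succ_ne_zero).mul (hq _ (2 * n).succ_ne_zero)
    have hsum := sum_slaterAlpha_mul_baileyKernel_sub hq n (n + 1)
    rw [baileyKernel_eq_zero (by lia), mul_zero] at hsum
    rw [← hu.mul_right_inj, slaterBeta_succ hq, ih,
      sum_range_mul_baileyKernel _ (show n < 2 * (n + 1) + 1 by lia),
      sum_range_mul_baileyKernel _ (show n + 1 < 2 * (n + 1) + 1 by lia), mul_sum, mul_sum,
      ← sub_eq_zero, ← sum_sub_distrib, ← neg_eq_zero, ← sum_neg_distrib, ← hsum]
    exact sum_congr rfl fun k _ => by ring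

end SlaterPair

section TruncatedBailey

variable {R : Type*} [CommRing R]

theorem isUnit_one_sub_X_pow (n : ℕ) (hn : n ≠ 0) : IsUnit (1 - X ^ n : R⟦X⟧) := by
  simp [PowerSeries.isUnit_iff_constantCoeff, hn]

theorem X_pow_dvd_qPoch_sub {a b : ℕ} (h : a ≤ b) :
    (X : R⟦X⟧) ^ (a + 1) ∣ qPoch X b - qPoch X a := by
  induction b, h using Nat.le_induction with
  | base => simp
  | succ b hab ih =>
    rw [qPoch_succ, mul_sub, mul_one, sub_right_comm]
    exact dvd_sub ih (dvd_mul_of_dvd_right (pow_dvd_pow _ (by lia)) _)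

theorem X_pow_dvd_qPoch_mul_inverse_sub_one {a b c : ℕ} (hb : a ≤ b) (hc : a ≤ c) :
    (X : R⟦X⟧) ^ (a + 1) ∣ qPoch X b * (qPoch X c)⁻¹ʳ - 1 := by
  have hinv := Ring.mul_inverse_cancel _ (isUnit_qPoch (isUnit_one_sub_X_pow (R := R)) c)
  have hbc : (X : R⟦X⟧) ^ (a + 1) ∣ qPoch X b - qPoch X c := by
    simpa using dvd_sub (X_pow_dvd_qPoch_sub (R := R) hb) (X_pow_dvd_qPoch_sub hc)
  rw [← hinv, ← sub_mul]
  exact dvd_mul_of_dvd_left hbc _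

theorem X_pow_dvd_X_pow_mul_baileyKernel_sub_one (N k : ℕ) :
    (X : R⟦X⟧) ^ (N + 1) ∣ X ^ k * (qPoch X N ^ 2 * baileyKernel X N k - 1) := by
  obtain h | h := lt_or_ge N k
  · exact dvd_mul_of_dvd_left (pow_dvd_pow _ h) _
  · obtain ⟨m, rfl⟩ := Nat.exists_eq_add_of_le' h
    have hlow := X_pow_dvd_qPoch_mul_inverse_sub_one (R := R) (m.le_add_right k) le_rfl
    have hhigh := X_pow_dvd_qPoch_mul_inverse_sub_one (R := R) (m.le_add_right k)
      (show m ≤ m + k + k by lia)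
    rw [show m + k + 1 = k + (m + 1) by lia, pow_add, baileyKernel_add_left]
    refine mul_dvd_mul_left _ ?_
    convert (hlow.mul_right (qPoch X (m + k) * (qPoch X (m + k + k))⁻¹ʳ)).add hhigh using 1
    ring

theorem IsBaileyPair.X_pow_dvd_sum_sub {α β : ℕ → R⟦X⟧} (h : IsBaileyPair X α β) (N : ℕ) :
    X ^ (N + 1) ∣ ∑ n ∈ range N, X ^ (n + 1) * qPoch X n ^ 2 * β (n + 1) -
      ∑ n ∈ range N, (α 0 + α (n + 1)) * (X ^ (n + 1) * ((1 - X ^ (n + 1)) ^ 2)⁻¹ʳ) := by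
  rw [h.sum_qPoch_sq_mul isUnit_one_sub_X_pow, ← sum_sub_distrib]
  refine dvd_sum fun n _ => ?_
  convert (X_pow_dvd_X_pow_mul_baileyKernel_sub_one (R := R) N (n + 1)).mul_right
    (α (n + 1) * ((1 - X ^ (n + 1)) ^ 2)⁻¹ʳ) using 1
  ring

end TruncatedBailey

section LambertSeries

variable {R : Type*} [CommRing R]

theorem coeff_inverse_one_sub_X_pow {b : ℕ} (hb : b ≠ 0) (k : ℕ) :
    coeff k (1 - X ^ b : R⟦X⟧)⁻¹ʳ = if b ∣ k then 1 else 0 := by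
  have hgeom : expand b hb (PowerSeries.mk 1) * (1 - X ^ b) = (1 : R⟦X⟧) := by
    simpa using congrArg (expand b hb) (mk_one_mul_one_sub_eq_one R)
  rw [← one_mul (1 - X ^ b)⁻¹ʳ,
    ← (Ring.eq_mul_inverse_iff_mul_eq _ _ _ (isUnit_one_sub_X_pow b hb)).2 hgeom, coeff_expand]
  simp

theorem coeff_X_pow_mul_inverse_one_sub_X_pow (e : ℕ) {b : ℕ} (hb : b ≠ 0) (k : ℕ) :
    coeff k (X ^ e * (1 - X ^ b : R⟦X⟧)⁻¹ʳ) = if e ≤ k ∧ b ∣ k - e then 1 else 0 := by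
  rw [coeff_X_pow_mul', coeff_inverse_one_sub_X_pow hb, ite_and]

theorem coeff_sum_lambert (a : ℕ → ℕ) {b k N : ℕ} (ha : ∀ d, a d ≠ 0) (hb : b ≠ 0) (hk : k ≤ N) :
    coeff k (∑ n ∈ range N, (X : R⟦X⟧) ^ ((n + 1) * a (n + 1)) *
      (1 - (X : R⟦X⟧) ^ ((n + 1) * b))⁻¹ʳ) =
      #{p ∈ k.divisorsAntidiagonal | a p.1 ≤ p.2 ∧ b ∣ p.2 - a p.1} := by
  have hcoeff (n : ℕ) := coeff_X_pow_mul_inverse_one_sub_X_pow (R := R) ((n + 1) * a (n + 1))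
    (mul_ne_zero n.succ_ne_zero hb) k
  simp only [map_sum, hcoeff, sum_boole]
  congr 1
  refine card_nbij' (fun n => (n + 1, k / (n + 1))) (fun p => p.1 - 1) ?_ ?_ ?_ ?_
  · intro n hn
    obtain ⟨hle, t, ht⟩ := (mem_filter.1 hn).2
    obtain rfl : k = (n + 1) * (a (n + 1) + b * t) := by
      rw [mul_add, ← mul_assoc, ← ht, Nat.add_sub_cancel' hle]
    simp [ha]
  · rintro ⟨d, c⟩ hp
    obtain ⟨hdc, hac, hbc⟩ := mem_filter.1 hp
    obtain ⟨hdk, hk0⟩ := Nat.mem_divisorsAntidiagonal.1 hdc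
    obtain ⟨d, rfl⟩ := Nat.exists_eq_succ_of_ne_zero (left_ne_zero_of_mul (hdk ▸ hk0))
    subst hdk
    have hd : d < N := (Nat.le_mul_of_pos_right _ (right_ne_zero_of_mul hk0).pos).trans hk
    simpa [hd, ← Nat.mul_sub] using ⟨hac, Nat.mul_dvd_mul_left (d + 1) hbc⟩
  · exact fun _ _ => rfl
  · rintro ⟨d, c⟩ hp
    obtain ⟨hdk, hk0⟩ := Nat.mem_divisorsAntidiagonal.1 (mem_filter.1 hp).1
    obtain ⟨d, rfl⟩ := Nat.exists_eq_succ_of_ne_zero (left_ne_zero_of_mul (hdk ▸ hk0))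
    simp [← hdk]

/-- When an even number is factored with an odd second factor, the two factors have opposite
parities and are therefore distinct, so exactly one of the two orders is increasing. -/
theorem card_divisorsAntidiagonal_odd_snd {k : ℕ} (hk : Even k) :
    #{p ∈ k.divisorsAntidiagonal | Odd p.2} =
      #{p ∈ k.divisorsAntidiagonal | p.1 < p.2 ∧ Odd (p.1 + p.2)} := by
  refine card_nbij' (fun p => if p.1 < p.2 then p else p.swap)
    (fun p => if Odd p.2 then p else p.swap) ?_ ?_ ?_ ?_
  all_goals
    rintro ⟨c, d⟩ hp
    obtain ⟨hdiv, hcond⟩ := mem_filter.1 hp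
    have hcd : Even c ∨ Even d :=
      Nat.even_mul.1 ((Nat.mem_divisorsAntidiagonal.1 hdiv).1 ▸ hk)
    have hswap : (d, c) ∈ k.divisorsAntidiagonal := Nat.swap_mem_divisorsAntidiagonal.2 hdiv
    grind

end LambertSeries

section ModTwo

variable {R : Type*} [CommRing R] [CharP R 2]

theorem inverse_sq_one_sub (f : R) : ((1 - f) ^ 2)⁻¹ʳ = (1 - f ^ 2)⁻¹ʳ := by
  rw [CharTwo.sub_eq_add, CharTwo.sub_eq_add, CharTwo.add_sq, one_pow]

theorem slaterAlpha_two_mul_add_two_mul {q : R} (hq : ∀ n ≠ 0, IsUnit (1 - q ^ n)) (r : ℕ) :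
    slaterAlpha q (2 * r + 2) * (q ^ (2 * r + 2) * ((1 - q ^ (2 * r + 2)) ^ 2)⁻¹ʳ) =
      q ^ ((r + 1) * (r + 2)) * (1 - q ^ ((r + 1) * 2))⁻¹ʳ := by
  have hinv := Ring.mul_inverse_cancel _ (hq (2 * r + 2) (by lia))
  rw [slaterAlpha_two_mul_add_two, CharTwo.neg_eq, one_pow, ← CharTwo.sub_eq_add,
    ← Ring.inverse_pow, show (r + 1) * 2 = 2 * r + 2 by ring,
    show (r + 1) * (r + 2) = (r + 1) * r + (2 * r + 2) by ring]
  linear_combination q ^ ((r + 1) * r + (2 * r + 2)) * (1 - q ^ (2 * r + 2))⁻¹ʳ * hinv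

theorem sum_one_add_slaterAlpha_mul {q : R} (hq : ∀ n ≠ 0, IsUnit (1 - q ^ n)) (M : ℕ) :
    ∑ n ∈ range (2 * M), (1 + slaterAlpha q (n + 1)) *
        (q ^ (n + 1) * ((1 - q ^ (n + 1)) ^ 2)⁻¹ʳ) =
      ∑ n ∈ range (2 * M), q ^ (n + 1) * (1 - q ^ ((n + 1) * 2))⁻¹ʳ +
        ∑ r ∈ range M, q ^ ((r + 1) * (r + 2)) * (1 - q ^ ((r + 1) * 2))⁻¹ʳ := by
  simp only [one_add_mul, sum_add_distrib]
  congr 1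
  · exact sum_congr rfl fun n _ => by rw [inverse_sq_one_sub, pow_mul]
  · induction M with
    | zero => simp
    | succ M ih =>
      rw [mul_add_one, sum_range_succ, sum_range_succ, ih, sum_range_succ,
        slaterAlpha_two_mul_add_one, zero_mul, add_zero, slaterAlpha_two_mul_add_two_mul hq]

theorem coeff_sum_slaterBeta_of_even {k M : ℕ} (hk : Even k) (hkM : k ≤ M) :
    coeff k (∑ n ∈ range (2 * M), (X : R⟦X⟧) ^ (n + 1) * qPoch X n ^ 2 * slaterBeta X (n + 1)) =
      0 := by
  have : CharP R⟦X⟧ 2 := charP_of_injective_ringHom C_injective 2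
  have hodd : #{p ∈ k.divisorsAntidiagonal | 1 ≤ p.2 ∧ 2 ∣ p.2 - 1} =
      #{p ∈ k.divisorsAntidiagonal | Odd p.2} :=
    congrArg card (filter_congr fun p _ => by grind)
  have hopp : #{p ∈ k.divisorsAntidiagonal | p.1 + 1 ≤ p.2 ∧ 2 ∣ p.2 - (p.1 + 1)} =
      #{p ∈ k.divisorsAntidiagonal | p.1 < p.2 ∧ Odd (p.1 + p.2)} :=
    congrArg card (filter_congr fun p _ => by grind)
  have hfst := coeff_sum_lambert (R := R) (fun _ => 1) (fun _ => one_ne_zero) two_ne_zero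
    (hkM.trans (Nat.le_mul_of_pos_left M two_pos))
  have hsnd := coeff_sum_lambert (R := R) (· + 1) Nat.succ_ne_zero two_ne_zero hkM
  obtain ⟨g, hg⟩ := isBaileyPair_slater (isUnit_one_sub_X_pow (R := R)) |>.X_pow_dvd_sum_sub (2 * M)
  rw [sub_eq_iff_eq_add, slaterAlpha_zero, sum_one_add_slaterAlpha_mul isUnit_one_sub_X_pow] at hg
  simp only [mul_one] at hfst
  rw [hg, map_add, map_add, coeff_X_pow_mul', if_neg (by lia), zero_add, hfst, hsnd, hodd, hopp,
    card_divisorsAntidiagonal_odd_snd hk, CharTwo.add_self_eq_zero]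

end ModTwo

section OddSupport

variable {R : Type*} [CommRing R]

theorem coeff_inverse_qPoch_X_sq_of_odd (M : ℕ) {k : ℕ} (hk : Odd k) :
    coeff k (qPoch (X ^ 2 : R⟦X⟧) M)⁻¹ʳ = 0 := by
  have hexpand : (qPoch (X ^ 2 : R⟦X⟧) M)⁻¹ʳ = expand 2 two_ne_zero (qPoch X M)⁻¹ʳ := by
    rw [map_ringInverse _ (isUnit_qPoch isUnit_one_sub_X_pow M)]
    congr 1
    exact ((map_qPoch (expand 2 two_ne_zero : R⟦X⟧ →ₐ[R] R⟦X⟧).toRingHom X M).trans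
      (congrArg (qPoch · M) (expand_X 2 two_ne_zero))).symm
  rw [hexpand, coeff_expand_of_not_dvd _ _ _ (by rwa [← even_iff_two_dvd, Nat.not_even_iff_odd])]

theorem coeff_mul_eq_zero_of_even {S : Type*} [Semiring S] {f g : S⟦X⟧} {m : ℕ} (hm : Even m)
    (hf : ∀ k, Odd k → coeff k f = 0) (hg : ∀ k ≤ m, Even k → coeff k g = 0) :
    coeff m (f * g) = 0 := by
  rw [coeff_mul]
  refine sum_eq_zero fun p hp => ?_
  have hsum := mem_antidiagonal.1 hp
  obtain h | h := Nat.even_or_odd p.1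
  · rw [hg p.2 (by lia) ((Nat.even_add.1 (hsum ▸ hm)).1 h), mul_zero]
  · rw [hf p.1 h, zero_mul]

theorem coeff_inverse_qPoch_mul_sum_slaterBeta_of_even [CharP R 2] {m M : ℕ} (hm : Even m)
    (hmM : m ≤ M) :
    coeff m ((qPoch (X ^ 2 : R⟦X⟧) (2 * M))⁻¹ʳ *
      ∑ n ∈ range (2 * M), X ^ (n + 1) * qPoch X n ^ 2 * slaterBeta X (n + 1)) = 0 :=
  coeff_mul_eq_zero_of_even hm (fun _ => coeff_inverse_qPoch_X_sq_of_odd _)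
    fun _ hk heven => coeff_sum_slaterBeta_of_even heven (hk.trans hmM)

end OddSupport

section RestrictedPartitions

open Nat.Partition

variable {R : Type*} [CommRing R] {A : Finset ℕ}

open scoped PowerSeries.WithPiTopology in
theorem mk_card_restricted_eq_prod (hA : 0 ∉ A) :
    PowerSeries.mk (fun n => (#(restricted n (· ∈ A)) : R)) = ∏ i ∈ A, (1 - X ^ i)⁻¹ʳ := by
  let _ : TopologicalSpace R := ⊥
  have _ : DiscreteTopology R := ⟨rfl⟩
  have hA' {i : ℕ} (hi : i ∈ A) : i ≠ 0 := ne_of_mem_of_not_mem hi hA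
  have hgeom {i : ℕ} (hi : i ∈ A) : ∑' j, X ^ (i * j) = (1 - X ^ i : R⟦X⟧)⁻¹ʳ := by
    rw [← one_mul (1 - X ^ i)⁻¹ʳ,
      Ring.eq_mul_inverse_iff_mul_eq _ _ _ (isUnit_one_sub_X_pow i (hA' hi))]
    simp only [pow_mul]
    exact WithPiTopology.tsum_pow_mul_one_sub_of_constantCoeff_eq_zero (by simp [hA' hi])
  have hfinite := hasProd_prod_of_ne_finset_one (L := .unconditional ℕ) (s := A.image (· - 1))
    (f := fun i => if i + 1 ∈ A then ∑' j, (X : R⟦X⟧) ^ ((i + 1) * j) else 1)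
    fun i hi => if_neg fun h => hi (mem_image_of_mem (· - 1) h)
  rw [(hasProd_powerSeriesMk_card_restricted R (· ∈ A)).unique hfinite, prod_image]
  · refine prod_congr rfl fun i hi => ?_
    rw [Nat.sub_add_cancel (hA' hi).pos, if_pos hi, hgeom hi]
  · intro i hi j hj h
    exact Nat.pred_inj (hA' hi).pos (hA' hj).pos h

theorem sum_restricted_count_eq {p : ℕ → Prop} [DecidablePred p] {n s : ℕ} (hs0 : 1 ≤ s)
    (hsn : s ≤ n) (hs : p s) :
    ∑ π ∈ restricted n p, π.parts.count s = ∑ ρ ∈ restricted (n - s) p, (ρ.parts.count s + 1) := by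
  let e := partitionWithPartEquiv hs0 hsn
  have hparts (ρ : (n - s).Partition) : (e.symm ρ).1.parts = s ::ₘ ρ.parts :=
    partitionWithPartEquiv_symm_apply_parts hs0 hsn ρ
  symm
  calc
    _ = ∑ π ∈ restricted n p with s ∈ π.parts, π.parts.count s := by
      refine sum_nbij (fun ρ => (e.symm ρ).1) ?_
        (Subtype.val_injective.comp e.symm.injective).injOn ?_ ?_
      · intro ρ hρ
        simp_all [restricted]
      · intro π hπ
        have hsπ := (mem_filter.1 hπ).2
        refine ⟨e ⟨π, hsπ⟩, ?_, by simp⟩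
        have := hparts (e ⟨π, hsπ⟩)
        simp_all [restricted]
      · intro ρ _
        simp [hparts]
    _ = ∑ π ∈ restricted n p, π.parts.count s :=
      sum_filter_of_ne fun π _ => Multiset.count_ne_zero.1

theorem mk_sum_restricted_count_eq {s : ℕ} (hA : 0 ∉ A) (hs : s ∈ A) :
    PowerSeries.mk (fun n => ((∑ π ∈ restricted n (· ∈ A), π.parts.count s : ℕ) : R)) =
      X ^ s * (1 - X ^ s)⁻¹ʳ * ∏ i ∈ A, (1 - X ^ i)⁻¹ʳ := by
  have hs0 : s ≠ 0 := ne_of_mem_of_not_mem hs hA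
  rw [mul_right_comm, Ring.eq_mul_inverse_iff_mul_eq _ _ _ (isUnit_one_sub_X_pow s hs0),
    ← mk_card_restricted_eq_prod hA]
  ext n
  rw [mul_one_sub, map_sub, mul_comm, coeff_X_pow_mul', coeff_X_pow_mul']
  simp only [coeff_mk]
  split_ifs with hsn
  · rw [sum_restricted_count_eq hs0.pos hsn hs]
    simp [sum_add_distrib]
  · have hcount : ∀ π ∈ restricted n (· ∈ A), π.parts.count s = 0 := fun π _ =>
      Multiset.count_eq_zero.2 fun h => hsn (Nat.Partition.le_of_mem_parts h)
    rw [sum_eq_zero hcount, Nat.cast_zero, sub_zero]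

end RestrictedPartitions

section AdmissibleParts

/-- The parts, up to the bound `2 * N`, allowed in a partition with smallest part `s` that has no
odd part greater than `2 * s`. -/
def admissibleParts (s N : ℕ) : Finset ℕ :=
  Icc s (2 * s) ∪ (Ioc s N).image (2 * ·)

theorem mem_admissibleParts {s N i : ℕ} :
    i ∈ admissibleParts s N ↔ s ≤ i ∧ (i ≤ 2 * s ∨ Even i ∧ i ≤ 2 * N) := by
  simp only [admissibleParts, mem_union, mem_Icc, mem_image, mem_Ioc, even_iff_exists_two_mul]
  constructor
  · grind
  · rintro ⟨hs, h | ⟨⟨w, rfl⟩, hN⟩⟩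
    · exact .inl ⟨hs, h⟩
    · by_cases hw : w ≤ s
      · exact .inl ⟨hs, by lia⟩
      · exact .inr ⟨w, by lia, rfl⟩

theorem prod_admissibleParts_inverse {R : Type*} [CommRing R] {q : R}
    (hq : ∀ n ≠ 0, IsUnit (1 - q ^ n)) {n N : ℕ} (hn : n < N) :
    ∏ i ∈ admissibleParts (n + 1) N, (1 - q ^ i)⁻¹ʳ =
      qPoch q n * (qPoch q (2 * (n + 1)))⁻¹ʳ *
        (qPoch (q ^ 2) (n + 1) * (qPoch (q ^ 2) N)⁻¹ʳ) := by
  have hq2 (k : ℕ) (hk : k ≠ 0) : IsUnit (1 - (q ^ 2) ^ k) := by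
    rw [← pow_mul]
    exact hq _ (mul_ne_zero two_ne_zero hk)
  have hdisj : Disjoint (Icc (n + 1) (2 * (n + 1))) ((Ioc (n + 1) N).image (2 * ·)) := by
    simp only [disjoint_left, mem_Icc, mem_image, mem_Ioc]
    grind
  rw [admissibleParts, prod_union hdisj, prod_image (by simp), Icc_add_one_left_eq_Ioc,
    prod_Ioc_inverse_one_sub_pow hq (by lia), ← prod_Ioc_inverse_one_sub_pow hq2 hn]
  simp only [pow_mul]

theorem mk_sum_count_admissibleParts {R : Type*} [CommRing R] {n N : ℕ} (hn : n < N) :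
    X ^ (n + 1).choose 2 * PowerSeries.mk (fun a =>
        ((∑ π ∈ Nat.Partition.restricted a (· ∈ admissibleParts (n + 1) N),
          π.parts.count (n + 1) : ℕ) : R)) =
      (qPoch (X ^ 2) N)⁻¹ʳ * (X ^ (n + 1) * qPoch X n ^ 2 * slaterBeta X (n + 1)) := by
  have hfactor := prod_Ioc_inverse_one_sub_pow (isUnit_one_sub_X_pow (R := R)) (n.le_add_right 1)
  rw [Nat.Ioc_succ_singleton, prod_singleton] at hfactor
  rw [mk_sum_restricted_count_eq (by simp [mem_admissibleParts]) (by simp [mem_admissibleParts]),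
    prod_admissibleParts_inverse isUnit_one_sub_X_pow hn, slaterBeta, hfactor]
  ring

end AdmissibleParts

section SmallestPart

theorem smallestPart_eq_iff {m s : ℕ} (π : m.Partition) (hs : s ≠ 0) :
    smallestPart π = s ↔ s ∈ π.parts ∧ ∀ i ∈ π.parts, s ≤ i := by
  constructor
  · rintro rfl
    cases hmin : π.parts.toFinset.min with
    | top => simp [smallestPart, hmin] at hs
    | coe t =>
      rw [smallestPart, hmin, WithTop.untopD_coe]
      exact ⟨Multiset.mem_toFinset.1 (mem_of_min hmin),
        fun i hi => min_le_of_eq (Multiset.mem_toFinset.2 hi) hmin⟩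
  · rintro ⟨hmem, hle⟩
    have hmin : π.parts.toFinset.min = WithTop.some s :=
      le_antisymm (min_le (Multiset.mem_toFinset.2 hmem)) <| Finset.le_min fun i hi =>
        WithTop.coe_le_coe.2 (hle i (Multiset.mem_toFinset.1 hi))
    rw [smallestPart, hmin, WithTop.untopD_coe]

theorem smallestPart_le {m : ℕ} (π : m.Partition) : smallestPart π ≤ m := by
  obtain h | h := eq_or_ne (smallestPart π) 0
  · simp [h]
  · exact Nat.Partition.le_of_mem_parts ((smallestPart_eq_iff π h).1 rfl).1

theorem mem_restricted_admissibleParts_iff {m s N : ℕ} {π : m.Partition} (hs : s ∈ π.parts)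
    (hm : m ≤ 2 * N) :
    π ∈ Nat.Partition.restricted m (· ∈ admissibleParts s N) ↔
      NoLargeOddParts π ∧ smallestPart π = s := by
  have hbound {i : ℕ} (hi : i ∈ π.parts) : i ≤ 2 * N :=
    (Nat.Partition.le_of_mem_parts hi).trans hm
  have hsmallest := smallestPart_eq_iff π (π.parts_pos hs).ne'
  simp only [Nat.Partition.restricted, mem_filter, mem_univ, true_and, mem_admissibleParts,
    NoLargeOddParts]
  grind

theorem sum_triangularParts (l : ℕ) : (triangularParts l).sum = l.choose 2 := by
  rw [Nat.choose_two_right, ← sum_range_id, triangularParts, sum_val]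
  cases l with
  | zero => rfl
  | succ l => rw [sum_range_eq_add_Ico _ l.succ_pos]; simp

theorem card_parts_eq_triangularParts (l b : ℕ) :
    #{σ : b.Partition | σ.parts = triangularParts l} = if l.choose 2 = b then 1 else 0 := by
  split_ifs with h
  · let δ : b.Partition :=
      ⟨triangularParts l, fun {i} hi => (mem_Ico.1 (show i ∈ Ico 1 l from hi)).1,
        (sum_triangularParts l).trans h⟩
    refine card_eq_one.2 ⟨δ, ?_⟩
    ext σ
    simp [Nat.Partition.ext_iff, δ]
  · refine card_eq_zero.2 (filter_eq_empty_iff.2 fun σ _ hσ => h ?_)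
    rw [← sum_triangularParts, ← hσ, σ.parts_sum]

theorem sptOMinus_eq_sum (m : ℕ) :
    sptOMinus m = ∑ p ∈ antidiagonal m, ∑ π : p.1.Partition with NoLargeOddParts π,
      if (smallestPart π).choose 2 = p.2 then π.parts.count (smallestPart π) else 0 := by
  refine sum_congr rfl fun p _ => ?_
  calc
    _ = ∑ π : p.1.Partition with NoLargeOddParts π,
        ∑ τ : p.2.Partition with τ.parts = triangularParts (smallestPart π),
          π.parts.count (smallestPart π) := by
      rw [sum_filter, Fintype.sum_prod_type, sum_filter]
      refine sum_congr rfl fun π _ => ?_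
      split_ifs with hπ
      · simp only [hπ, and_true, sum_filter]
      · simp only [hπ, and_false, if_false, sum_const_zero]
    _ = _ := by
      simp only [sum_const, card_parts_eq_triangularParts, smul_eq_mul, ite_mul, one_mul, zero_mul]

theorem sum_noLargeOddParts_with_smallestPart {m s N : ℕ} (hm : m ≤ 2 * N) :
    ∑ π : m.Partition with NoLargeOddParts π ∧ smallestPart π = s, π.parts.count s =
      ∑ π ∈ Nat.Partition.restricted m (· ∈ admissibleParts s N), π.parts.count s := by
  rw [sum_filter, Nat.Partition.restricted, sum_filter]
  refine sum_congr rfl fun π _ => ?_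
  by_cases hs : s ∈ π.parts
  · have := mem_restricted_admissibleParts_iff hs hm
    simp only [Nat.Partition.restricted, mem_filter_univ] at this
    simp only [this]
  · simp only [Multiset.count_eq_zero.2 hs, ite_self]

theorem sum_noLargeOddParts_eq {a N : ℕ} (b : ℕ) (ha : a ≤ N) :
    (∑ π : a.Partition with NoLargeOddParts π,
      if (smallestPart π).choose 2 = b then π.parts.count (smallestPart π) else 0) =
    ∑ n ∈ range N, if (n + 1).choose 2 = b then
      ∑ π ∈ Nat.Partition.restricted a (· ∈ admissibleParts (n + 1) N), π.parts.count (n + 1)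
      else 0 := by
  have hmaps : ∀ π ∈ univ.filter (NoLargeOddParts (m := a)), smallestPart π ∈ range (N + 1) :=
    fun π _ => mem_range_succ_iff.2 ((smallestPart_le π).trans ha)
  have hfiber (s : ℕ) :
      (∑ π ∈ univ.filter (NoLargeOddParts (m := a)) with smallestPart π = s,
        if (smallestPart π).choose 2 = b then π.parts.count (smallestPart π) else 0) =
      if s.choose 2 = b then
        ∑ π ∈ Nat.Partition.restricted a (· ∈ admissibleParts s N), π.parts.count s else 0 := by
    rw [← sum_noLargeOddParts_with_smallestPart (ha.trans (Nat.le_mul_of_pos_left N two_pos)),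
      filter_filter]
    split_ifs with hs
    · exact sum_congr rfl fun π hπ => by rw [(mem_filter.1 hπ).2.2, if_pos hs]
    · exact sum_eq_zero fun π hπ => by rw [(mem_filter.1 hπ).2.2, if_neg hs]
  have hzero (π : a.Partition) : π.parts.count 0 = 0 :=
    Multiset.count_eq_zero.2 fun h => (π.parts_pos h).ne rfl
  rw [← sum_fiberwise_of_maps_to hmaps, sum_congr rfl fun s _ => hfiber s, sum_range_succ']
  simp only [hzero, sum_const_zero, ite_self, add_zero]

theorem natCast_sptOMinus_eq_coeff (R : Type*) [CommRing R] {m N : ℕ} (hm : m ≤ N) :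
    (sptOMinus m : R) = coeff m ((qPoch (X ^ 2) N)⁻¹ʳ *
      ∑ n ∈ range N, X ^ (n + 1) * qPoch X n ^ 2 * slaterBeta X (n + 1)) := by
  rw [sptOMinus_eq_sum, mul_sum, map_sum, sum_congr rfl fun p hp =>
    sum_noLargeOddParts_eq p.2 ((HasAntidiagonal.antidiagonal.fst_le hp).trans hm), sum_comm,
    Nat.cast_sum]
  refine sum_congr rfl fun n hn => ?_
  rw [← mk_sum_count_admissibleParts (mem_range.1 hn), mul_comm, coeff_mul, Nat.cast_sum]
  refine sum_congr rfl fun p _ => ?_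
  simp only [coeff_mk, coeff_X_pow, mul_ite, mul_one, mul_zero, Nat.cast_ite, Nat.cast_zero,
    eq_comm]

end SmallestPart

theorem theorem4 (n : ℕ) : Even (sptOMinus (2 * n)) := by
  rw [← ZMod.natCast_eq_zero_iff_even,
    natCast_sptOMinus_eq_coeff (ZMod 2) (Nat.le_mul_of_pos_left (2 * n) two_pos)]
  exact coeff_inverse_qPoch_mul_sum_slaterBeta_of_even (even_two_mul n) le_rfl
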